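/- Let $m \neq \pm 1$ be a squarefree integer and let $K = \mathbb{Q}(\alpha)$ be a number field generated by a root $\alpha$ of the polynomial $F(x) = x^{60} - m$ (which is irreducible over $\mathbb{Q}$). Let $\mathbb{Z}_K$ be the ring of integers of $K$. The field $K$ is called monogenic if there is $\theta \in \mathbb{Z}_K$ with $K = \mathbb{Q}(\theta)$ and index $(\mathbb{Z}_K : \mathbb{Z}[\theta]) = 1$, that is, if $(1, \theta, \dots, \theta^{59})$ is a $\mathbb{Z}$-basis of $\mathbb{Z}_K$ for some $\theta$. If one of the following statements holds, 1. $m \equiv 1 \pmod 4$, 2. $m \equiv \pm 1 \pmod 9$, 3. $m \equiv \pm 1 \pmod{25}$, then $K$ is not monogenic. -/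

import Mathlib

/-- The index `(ℤ_K : ℤ[θ])` of the subring `ℤ[θ]` in the ring of integers `ℤ_K = 𝓞 K`, as additive
groups. -/
noncomputable def integralIndex (K : Type*) [Field K] (θ : NumberField.RingOfIntegers K) : ℕ :=
  (Subring.toAddSubgroup (Algebra.adjoin ℤ {θ}).toSubring).index

/-- A number field `K` is monogenic if `(ℤ_K : ℤ[θ]) = 1` for some generator `θ ∈ ℤ_K` of `K`. -/
def IsMonogenicField (K : Type*) [Field K] [NumberField K] : Prop :=
  ∃ θ : NumberField.RingOfIntegers K,
    IntermediateField.adjoin ℚ {(θ : K)} = ⊤ ∧ integralIndex K θ = 1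

/-! If `𝓞 K = ℤ[θ]`, a ring homomorphism from `𝓞 K` to a field `k` is determined by the image of
`θ`, so there are no more of them than possible images. For `p = 2, 3, 5`, under the matching
congruence, there are too many.

Take `k = 𝔽_p` if `m ≡ 1` modulo 9 or 25, and `k = 𝔽_{p²}` if `m ≡ -1` or `p = 2`. Put `δ = ±α ^ (60
/ p)`; then `β = (1 + δ + ⋯ + δ ^ (p - 1)) / p` is integral. Each admissible value of `α` in `k`
comes from two reductions, separated by `β`. In `𝔽_{p²}` only reductions with `α` outside `𝔽_p` are
used, and these send `θ` outside `𝔽_p` as well. The counts are `4 > 3` and `8 > 5` for `m ≡ 1`, `8 >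
6` and `24 > 20` for `m ≡ -1`, and `4 > 2` for `p = 2`.

A reduction is obtained from a 60th root of `m` in `W(k)` or in an Eisenstein extension of it
(`NumberField.exists_ringHom_of_pow_eq`). For `p = 3, 5`, sending `δ` to a `p`-th root of `1 + p²n`
in `W(k)` gives `β ↦ 1`, and multiplying that root by a primitive `p`-th root of unity gives `β ↦
0`. For `p = 2` the two values of `β` are the roots of `b² - b = c`, where `m = 1 + 4c`. -/

open Polynomial NumberField WittVector

/-! ### Roots and Eisenstein extensions over Witt vectors -/

/-- Hensel's lemma for `𝕎 k` over its residue field. -/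
theorem WittVector.exists_isRoot_of_simple_root {p : ℕ} [Fact p.Prime] {k : Type*} [Field k]
    [CharP k p] [PerfectRing k p] (f : (WittVector p k)[X]) (hf : f.Monic) (a : k)
    (ha : (f.map WittVector.constantCoeff).eval a = 0) (ha' : ((derivative f).map WittVector.constantCoeff).eval a ≠ 0) :
    ∃ x : WittVector p k, f.IsRoot x ∧ WittVector.constantCoeff x = a := by
  obtain ⟨b, rfl⟩ := constantCoeff_surjective p a
  rw [eval_map_apply] at ha ha'
  have hI (y : WittVector p k) :
      y ∈ Ideal.span {(p : WittVector p k)} ↔ WittVector.constantCoeff y = 0 := by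
    rw [← ker_constantCoeff, RingHom.mem_ker]
  obtain ⟨x, hx, hxb⟩ := HenselianRing.is_henselian (I := Ideal.span {(p : WittVector p k)})
    f hf b ((hI _).2 ha) ((isUnit_of_coeff_zero_ne_zero _ ha').map _)
  refine ⟨x, hx, ?_⟩
  rw [hI, map_sub, sub_eq_zero] at hxb
  exact hxb

theorem WittVector.exists_pow_eq {p : ℕ} [Fact p.Prime] {k : Type*} [Field k]
    [CharP k p] [PerfectRing k p] {N : ℕ} (hN : (N : k) ≠ 0) (c : WittVector p k) {a : k}
    (ha0 : a ≠ 0) (ha : a ^ N = WittVector.constantCoeff c) :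
    ∃ x : WittVector p k, x ^ N = c ∧ WittVector.constantCoeff x = a := by
  have hN0 : N ≠ 0 := by rintro rfl; simp at hN
  obtain ⟨x, hx, hxa⟩ := WittVector.exists_isRoot_of_simple_root (X ^ N - C c)
    (monic_X_pow_sub_C c hN0) a (by simp only [Polynomial.map_sub, Polynomial.map_pow, map_X, map_C, eval_sub, eval_pow, eval_X,
      eval_C, ha, sub_self])
    (by rw [derivative_sub, derivative_C, sub_zero, derivative_X_pow]; simp [hN, ha0])
  exact ⟨x, by simpa [sub_eq_zero] using hx, hxa⟩

theorem WittVector.charZero_of_charP (p : ℕ) [Fact p.Prime] (k : Type*) [Field k]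
    [CharP k p] [PerfectRing k p] : CharZero (WittVector p k) := by
  refine charZero_of_inj_zero fun n => ?_
  induction n using Nat.strong_induction_on with
  | _ n ih =>
    intro hn
    have hk : (n : k) = 0 := by
      simpa only [map_natCast, map_zero] using congrArg WittVector.constantCoeff hn
    obtain ⟨d, rfl⟩ := (CharP.cast_eq_zero_iff k p n).1 hk
    rcases Nat.eq_zero_or_pos d with rfl | hd
    · rfl
    · have hp := (Fact.out : p.Prime).one_lt
      rw [ih d (by nlinarith)
        (eq_zero_of_p_mul_eq_zero _ (by rw [mul_comm]; exact_mod_cast hn)), mul_zero]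

/-- Adjoining a root of an Eisenstein polynomial to the Witt vectors gives an integrally closed
domain with the same residue field. -/
theorem WittVector.exists_eisenstein_extension.{u} {p : ℕ} [Fact p.Prime] {k : Type u} [Field k]
    [CharP k p] [PerfectRing k p] (g : (WittVector p k)[X]) (hg : g.Monic)
    (hdeg : 0 < g.natDegree) (hlow : ∀ i < g.natDegree, (p : WittVector p k) ∣ g.coeff i)
    (h0 : ¬ (p : WittVector p k) ^ 2 ∣ g.coeff 0) :
    ∃ (O : Type u) (_ : CommRing O) (_ : IsDomain O) (_ : IsIntegrallyClosed O) (_ : CharZero O)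
      (i : WittVector p k →+* O) (r : O →+* k) (ϖ : O),
      g.eval₂ i ϖ = 0 ∧ r ϖ = 0 ∧ ∀ w, r (i w) = WittVector.constantCoeff w := by
  set P : Ideal (WittVector p k) := Ideal.span {(p : WittVector p k)} with hP
  have hPmax : P.IsMaximal := by
    rw [hP, ← ker_constantCoeff]
    exact RingHom.ker_isMaximal_of_surjective _ (constantCoeff_surjective p)
  have hchar : CharZero (WittVector p k) := WittVector.charZero_of_charP p k
  have hE : g.IsEisensteinAt P := hg.isEisensteinAt_of_mem_of_notMem hPmax.ne_top
    (fun {i} hi => Ideal.mem_span_singleton.2 (hlow i hi))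
    (by rwa [hP, Ideal.span_singleton_pow, Ideal.mem_span_singleton])
  have hirr : Irreducible g := hE.irreducible hPmax.isPrime hg.isPrimitive hdeg
  have hprime : Prime g := hirr.prime
  have hdom : IsDomain (AdjoinRoot g) := AdjoinRoot.isDomain_of_prime hprime
  have hfin : Module.Finite (WittVector p k) (AdjoinRoot g) := hg.finite_adjoinRoot
  have hinj : Function.Injective (AdjoinRoot.of g) :=
    AdjoinRoot.of.injective_of_degree_ne_zero (by
      rw [degree_eq_natDegree hg.ne_zero]; exact_mod_cast hdeg.ne')
  have hdvd : (p : AdjoinRoot g) ∣ AdjoinRoot.root g ^ g.natDegree := by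
    have h := hE.isWeaklyEisensteinAt.pow_natDegree_le_of_aeval_zero_of_monic_mem_map
      (x := AdjoinRoot.root g) (by simp) hg _ (hg.natDegree_map _).le
    rwa [hP, Ideal.map_span, Set.image_singleton, Ideal.mem_span_singleton, map_natCast] at h
  have hsplit : ∀ z : AdjoinRoot g, ∃ (w : WittVector p k) (y : AdjoinRoot g),
      z = AdjoinRoot.of g w + AdjoinRoot.root g * y := by
    intro z
    induction z using AdjoinRoot.induction_on with
    | ih q =>
      refine ⟨q.coeff 0, AdjoinRoot.mk g q.divX, ?_⟩
      conv_lhs => rw [← divX_mul_X_add q]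
      rw [map_add, map_mul, AdjoinRoot.mk_X, AdjoinRoot.mk_C]; ring
  have hr0 : g.eval₂ WittVector.constantCoeff (0 : k) = 0 := by
    obtain ⟨c, hc⟩ := hlow 0 hdeg
    rw [eval₂_at_zero, hc, map_mul, map_natCast, CharP.cast_eq_zero, zero_mul]
  let r : AdjoinRoot g →+* k := AdjoinRoot.lift WittVector.constantCoeff 0 hr0
  have hrw (w : WittVector p k) : r (AdjoinRoot.of g w) = WittVector.constantCoeff w := by simp [r]
  have hrr : r (AdjoinRoot.root g) = 0 := by simp [r]
  -- The constant term of `g` is `p` times a unit, and it is a multiple of the root because `g`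
  -- vanishes there.
  have hpdvd : AdjoinRoot.root g ∣ (p : AdjoinRoot g) := by
    obtain ⟨c, hc⟩ := hlow 0 hdeg
    have hcu : IsUnit c := by
      refine isUnit_of_coeff_zero_ne_zero c fun h => h0 ?_
      obtain ⟨d, rfl⟩ := Ideal.mem_span_singleton.1 ((mem_span_p_iff_coeff_zero_eq_zero c).2 h)
      exact ⟨d, by rw [hc]; ring⟩
    have h := congrArg (AdjoinRoot.mk g) (divX_mul_X_add g)
    rw [AdjoinRoot.mk_self, map_add, map_mul, AdjoinRoot.mk_X, AdjoinRoot.mk_C, hc, map_mul,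
      map_natCast] at h
    have h2 : AdjoinRoot.root g ∣ (p : AdjoinRoot g) * AdjoinRoot.of g c :=
      ⟨-AdjoinRoot.mk g g.divX, by linear_combination h⟩
    exact (hcu.map (AdjoinRoot.of g)).dvd_mul_right.1 h2
  have hker : ∀ z, r z = 0 → AdjoinRoot.root g ∣ z := by
    intro z hz
    obtain ⟨w, y, rfl⟩ := hsplit z
    rw [map_add, map_mul, hrr, zero_mul, add_zero, hrw] at hz
    obtain ⟨d, rfl⟩ := Ideal.mem_span_singleton.1 ((mem_span_p_iff_coeff_zero_eq_zero w).2 hz)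
    rw [map_mul, map_natCast]
    exact dvd_add (hpdvd.mul_right _) (dvd_mul_right _ _)
  -- By integrality a maximal ideal `M` contracts to a maximal ideal of `W(k)`, so it contains `p`,
  -- hence the root, hence every `z` modulo its constant part.
  have hunit : ∀ z, r z ≠ 0 → IsUnit z := by
    intro z hz
    by_contra hnu
    obtain ⟨M, hM, hzM⟩ := exists_max_ideal_of_mem_nonunits hnu
    have hMc : (M.comap (algebraMap (WittVector p k) (AdjoinRoot g))).IsMaximal :=
      Ideal.isMaximal_comap_of_isIntegral_of_isMaximal M
    have hpM : (p : AdjoinRoot g) ∈ M := by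
      have h : (p : WittVector p k) ∈ M.comap (algebraMap (WittVector p k) (AdjoinRoot g)) := by
        by_contra h
        obtain ⟨y, i, hi, hy⟩ := hMc.exists_inv h
        have h1 : WittVector.constantCoeff i = (1 : k) := by
          have := congrArg WittVector.constantCoeff hy
          rwa [map_add, map_mul, map_natCast, CharP.cast_eq_zero, mul_zero, zero_add, map_one] at this
        exact hMc.ne_top (Ideal.eq_top_of_isUnit_mem _ hi
          (isUnit_of_coeff_zero_ne_zero i (by
            change WittVector.constantCoeff i ≠ 0
            rw [h1]; exact one_ne_zero)))
      simpa using h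
    have hrM : AdjoinRoot.root g ∈ M :=
      hM.isPrime.mem_of_pow_mem _ (M.mem_of_dvd hdvd hpM)
    obtain ⟨w, y, rfl⟩ := hsplit z
    rw [map_add, map_mul, hrr, zero_mul, add_zero, hrw] at hz
    have hw : AdjoinRoot.of g w ∈ M := (M.add_mem_iff_left (M.mul_mem_right _ hrM)).1 hzM
    exact hM.ne_top (Ideal.eq_top_of_isUnit_mem _ hw ((isUnit_of_coeff_zero_ne_zero w hz).map _))
  have hnonunit : ∀ z, z ∈ nonunits (AdjoinRoot g) ↔ r z = 0 := fun z =>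
    ⟨fun h => by_contra fun h' => h (hunit z h'), fun h hu => (hu.map r).ne_zero h⟩
  have hlocal : IsLocalRing (AdjoinRoot g) := IsLocalRing.of_nonunits_add fun a b ha hb => by
    rw [hnonunit] at *
    rw [map_add, ha, hb, add_zero]
  have hmax : (IsLocalRing.maximalIdeal (AdjoinRoot g)).IsPrincipal := by
    refine ⟨AdjoinRoot.root g, ?_⟩
    ext z
    rw [IsLocalRing.mem_maximalIdeal, hnonunit, Ideal.submodule_span_eq,
      Ideal.mem_span_singleton]
    refine ⟨hker z, ?_⟩
    rintro ⟨y, rfl⟩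
    rw [map_mul, hrr, zero_mul]
  have hnoeth : IsNoetherianRing (AdjoinRoot g) := IsNoetherianRing.of_finite (WittVector p k) _
  -- A Noetherian local domain with principal maximal ideal is a field or a discrete valuation ring.
  have hclosed : IsIntegrallyClosed (AdjoinRoot g) :=
    (show IsIntegrallyClosed (AdjoinRoot g) ∧ ∀ P : Ideal (AdjoinRoot g), P ≠ ⊥ → P.IsPrime →
        P = IsLocalRing.maximalIdeal (AdjoinRoot g) from
      ((tfae_of_isNoetherianRing_of_isLocalRing_of_isDomain (AdjoinRoot g)).out 4 3).1 hmax).1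
  exact ⟨AdjoinRoot g, inferInstance, hdom, hclosed, charZero_of_injective_ringHom hinj,
    AdjoinRoot.of g, r, AdjoinRoot.root g, AdjoinRoot.eval₂_root g, hrr, hrw⟩

/-! ### Homomorphisms from the ring of integers -/

/-- Eisenstein's criterion at any prime factor of `m`. -/
theorem Int.irreducible_X_pow_sub_C_of_squarefree {m : ℤ} (hm : Squarefree m) (hm1 : m ≠ 1)
    (hm2 : m ≠ -1) {n : ℕ} (hn : 0 < n) : Irreducible (X ^ n - C (m : ℚ)) := by
  obtain ⟨q, hq, d, rfl⟩ := WfDvdMonoid.exists_irreducible_factor (a := m)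
    (fun h => by rcases Int.isUnit_iff.1 h with h | h <;> contradiction) hm.ne_zero
  have hmonic : (X ^ n - C (q * d) : ℤ[X]).Monic := monic_X_pow_sub_C _ hn.ne'
  have hdeg : (X ^ n - C (q * d) : ℤ[X]).natDegree = n := natDegree_X_pow_sub_C
  have hE : (X ^ n - C (q * d) : ℤ[X]).IsEisensteinAt (Ideal.span {q}) := by
    refine hmonic.isEisensteinAt_of_mem_of_notMem ?_ ?_ ?_
    · exact fun h => hq.not_isUnit (Ideal.span_singleton_eq_top.1 h)
    · intro i hi
      rw [hdeg] at hi
      rw [coeff_sub, coeff_X_pow, if_neg hi.ne, zero_sub, Ideal.mem_span_singleton, coeff_C]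
      split_ifs <;> simp
    · rw [coeff_sub, coeff_X_pow, if_neg hn.ne, zero_sub, coeff_C_zero,
        Ideal.span_singleton_pow, Ideal.mem_span_singleton, dvd_neg, sq]
      exact fun h => hq.not_isUnit (hm _ h)
  have h := hE.irreducible ((Ideal.span_singleton_prime hq.ne_zero).2 hq.prime)
    hmonic.isPrimitive (by rw [hdeg]; exact hn)
  simpa using (hmonic.irreducible_iff_irreducible_map_fraction_map (K := ℚ)).1 h

/-- If `K = ℚ(α)` with `αⁿ = m` of degree `n`, an `n`-th root of `m` in an integrally closed domain
`O` of characteristic zero gives a ring homomorphism `𝓞 K → O`. -/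
theorem NumberField.exists_ringHom_of_pow_eq {m : ℤ} {n : ℕ} (hn : 0 < n)
    (hirr : Irreducible (X ^ n - C (m : ℚ))) {K : Type*} [Field K] [NumberField K] {α : 𝓞 K}
    (hroot : α ^ n = m) (hgen : IntermediateField.adjoin ℚ {(α : K)} = ⊤)
    {O : Type*} [CommRing O] [IsDomain O] [IsIntegrallyClosed O] [CharZero O]
    {x : O} (hx : x ^ n = m) : ∃ ι : 𝓞 K →+* O, ι α = x := by
  let F := FractionRing O
  have hinj : Function.Injective (algebraMap O F) := IsFractionRing.injective O F
  have : CharZero F := charZero_of_injective_algebraMap hinj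
  let _ : Algebra ℚ F := DivisionRing.toRatAlgebra
  have hαK : (α : K) ^ n = (m : K) := by
    have := congrArg (algebraMap (𝓞 K) K) hroot
    simpa using this
  have hint : IsIntegral ℚ (α : K) := (RingOfIntegers.isIntegral_coe α).tower_top
  have hmin : minpoly ℚ (α : K) = X ^ n - C (m : ℚ) :=
    (minpoly.eq_of_irreducible_of_monic hirr (by simp [hαK]) (monic_X_pow_sub_C _ hn.ne')).symm
  have hcard : aeval (algebraMap O F x) (minpoly ℚ (α : K)) = 0 := by
    have := congrArg (algebraMap O F) hx
    rw [hmin]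
    simp only [map_pow, map_intCast] at this
    simp [this]
  let pb := IntermediateField.adjoin.powerBasis hint
  let f₀ : IntermediateField.adjoin ℚ {(α : K)} →ₐ[ℚ] F :=
    pb.lift (algebraMap O F x) (by
      rw [IntermediateField.adjoin.powerBasis_gen, IntermediateField.minpoly_gen]; exact hcard)
  let f : K →ₐ[ℚ] F :=
    f₀.comp ((IntermediateField.equivOfEq hgen.symm).toAlgHom.comp
      IntermediateField.topEquiv.symm.toAlgHom)
  have hfα : f (α : K) = algebraMap O F x := by
    have h : f (α : K) = f₀ (IntermediateField.AdjoinSimple.gen ℚ (α : K)) := rfl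
    rw [h, ← IntermediateField.adjoin.powerBasis_gen hint]
    exact pb.lift_gen _ _
  -- Integral elements stay integral in the fraction field of `O`, hence lie in `O`.
  have hmem (z : 𝓞 K) : ∃ y : O, algebraMap O F y = f (z : K) := by
    apply IsIntegrallyClosed.isIntegral_iff.1
    obtain ⟨q, hq, hqz⟩ := map_isIntegral_int f (RingOfIntegers.isIntegral_coe z)
    refine ⟨q.map (Int.castRingHom O), hq.map _, ?_⟩
    rw [eval₂_map, ← hqz]
    congr 1
    exact RingHom.ext_int _ _
  choose ι hι using hmem
  refine ⟨{ toFun := ι, map_one' := hinj ?_, map_mul' := fun a b => hinj ?_,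
            map_zero' := hinj ?_, map_add' := fun a b => hinj ?_ }, hinj ?_⟩
  · simp [hι]
  · simp [hι]
  · simp [hι]
  · simp [hι]
  · exact (hι α).trans hfα

/-! ### Counting homomorphisms from a monogenic ring -/

theorem adjoin_eq_top_of_integralIndex_eq_one {K : Type*} [Field K] {θ : 𝓞 K}
    (h : integralIndex K θ = 1) : Algebra.adjoin ℤ {θ} = ⊤ := by
  rw [integralIndex, AddSubgroup.index_eq_one] at h
  rw [eq_top_iff]
  intro z _
  have : z ∈ Subring.toAddSubgroup (Algebra.adjoin ℤ {θ}).toSubring := h ▸ AddSubgroup.mem_top z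
  exact this

/-- Homomorphisms out of a ring generated by one element are determined by the image of it, so
there cannot be too many of them. -/
theorem not_isMonogenicField_of_ringHoms {K : Type*} [Field K] [NumberField K] {k : Type*}
    [Field k] (A B : Finset k) (hcard : B.card < 2 * A.card) (x y : 𝓞 K)
    (hB : ∀ φ : 𝓞 K →+* k, ∀ θ, Algebra.adjoin ℤ {θ} = ⊤ → φ x ∈ A → φ θ ∈ B)
    (hA : ∀ a ∈ A, ∃ φ₁ φ₂ : 𝓞 K →+* k, φ₁ x = a ∧ φ₂ x = a ∧ φ₁ y ≠ φ₂ y) :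
    ¬ IsMonogenicField K := by
  classical
  rintro ⟨θ, -, hθ⟩
  have htop := adjoin_eq_top_of_integralIndex_eq_one hθ
  choose φ₁ φ₂ h₁ h₂ hne using hA
  let ψ : A × Bool → (𝓞 K →+* k) := fun q => bif q.2 then φ₁ q.1 q.1.2 else φ₂ q.1 q.1.2
  have hψx (q) : ψ q x = q.1 := by
    obtain ⟨a, b⟩ := q
    cases b
    · exact h₂ a a.2
    · exact h₁ a a.2
  have hψ : Function.Injective ψ := by
    rintro ⟨a, b⟩ ⟨a', b'⟩ h
    obtain rfl : a = a' := Subtype.ext (by rw [← hψx (a, b), h, hψx])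
    have := hne a a.2
    cases b <;> cases b'
    · rfl
    · exact absurd (congrArg (· y) h.symm) this
    · exact absurd (congrArg (· y) h) this
    · rfl
  have hθinj : Function.Injective fun φ : 𝓞 K →+* k => φ θ := by
    intro φ φ' h
    have h1 : φ.toIntAlgHom = φ'.toIntAlgHom :=
      AlgHom.ext_of_adjoin_eq_top htop (by rintro _ rfl; exact h)
    exact RingHom.ext fun z => DFunLike.congr_fun h1 z
  have hle : Fintype.card (A × Bool) ≤ B.card := by
    rw [← Fintype.card_coe B]
    exact Fintype.card_le_of_injective
      (fun q => ⟨ψ q θ, hB _ _ htop (by rw [hψx]; exact q.1.2)⟩)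
      fun q q' h => hψ (hθinj (Subtype.ext_iff.1 h))
  rw [Fintype.card_prod, Fintype.card_coe, Fintype.card_bool] at hle
  omega

/-- If Frobenius fixes `φ θ`, then `φ` and its composite with Frobenius agree on a generator, hence
everywhere. -/
theorem pow_char_ne_of_adjoin_eq_top {R k : Type*} [CommRing R] [Field k] {p : ℕ} [Fact p.Prime]
    [CharP k p] (φ : R →+* k) {θ x : R} (hθ : Algebra.adjoin ℤ {θ} = ⊤) (hx : φ x ^ p ≠ φ x) :
    φ θ ^ p ≠ φ θ := by
  intro h
  have h1 : ((frobenius k p).comp φ).toIntAlgHom = φ.toIntAlgHom :=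
    AlgHom.ext_of_adjoin_eq_top hθ (by rintro _ rfl; exact h)
  exact hx (DFunLike.congr_fun h1 x)

/-! ### The integral element `β` and its images -/

theorem NumberField.RingOfIntegers.exists_mul_eq {K : Type*} [Field K] [NumberField K] {d : ℕ}
    (hd : d ≠ 0) (c : 𝓞 K) (h : ∀ b : K, d * b = c → IsIntegral ℤ b) :
    ∃ β : 𝓞 K, d * β = c := by
  have hdK : (d : K) ≠ 0 := Nat.cast_ne_zero.2 hd
  refine ⟨⟨(c : K) / d, h _ (mul_div_cancel₀ _ hdK)⟩, RingOfIntegers.ext ?_⟩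
  exact (map_mul (algebraMap (𝓞 K) K) _ _).trans
    (by rw [map_natCast]; exact mul_div_cancel₀ _ hdK)

theorem IsIntegrallyClosed.exists_ringHom_three {m n ε : ℤ} (hε : ε ^ 2 = 1)
    (hm : m = ε * (1 + 9 * n)) (hirr : Irreducible (X ^ 60 - C (m : ℚ)))
    {K : Type*} [Field K] [NumberField K] {α β : 𝓞 K} (hroot : α ^ 60 = m)
    (hgen : IntermediateField.adjoin ℚ {(α : K)} = ⊤)
    (hβ : 3 * β = 1 + ε * α ^ 20 + (ε * α ^ 20) ^ 2)
    {O : Type*} [CommRing O] [IsDomain O] [IsIntegrallyClosed O] [CharZero O]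
    {x w : O} (hw : w ^ 3 = 1 + 9 * n) (hx : x ^ 20 = ε * w) {b : O}
    (hb : 3 * b = 1 + w + w ^ 2) : ∃ ι : 𝓞 K →+* O, ι α = x ∧ ι β = b := by
  have hεO : (ε : O) ^ 2 = 1 := by exact_mod_cast hε
  obtain ⟨ι, hι⟩ := NumberField.exists_ringHom_of_pow_eq (by norm_num) hirr hroot hgen (x := x) (by
    rw [show x ^ 60 = (x ^ 20) ^ 3 by ring, hx, mul_pow, hw, hm]
    push_cast
    linear_combination ((ε : O) * (1 + 9 * n)) * hεO)
  refine ⟨ι, hι, mul_left_cancel₀ (by norm_num : (3 : O) ≠ 0) ?_⟩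
  have h := congrArg ι hβ
  simp only [map_mul, map_add, map_pow, map_one, map_ofNat, map_intCast, hι, hx] at h
  rw [h, hb]
  linear_combination (w + w ^ 2 * (ε ^ 2 + 1)) * hεO

theorem IsIntegrallyClosed.exists_ringHom_five {m n ε : ℤ} (hε : ε ^ 2 = 1)
    (hm : m = ε * (1 + 25 * n)) (hirr : Irreducible (X ^ 60 - C (m : ℚ)))
    {K : Type*} [Field K] [NumberField K] {α β : 𝓞 K} (hroot : α ^ 60 = m)
    (hgen : IntermediateField.adjoin ℚ {(α : K)} = ⊤)
    (hβ : 5 * β = 1 + ε * α ^ 12 + (ε * α ^ 12) ^ 2 + (ε * α ^ 12) ^ 3 + (ε * α ^ 12) ^ 4)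
    {O : Type*} [CommRing O] [IsDomain O] [IsIntegrallyClosed O] [CharZero O]
    {x w : O} (hw : w ^ 5 = 1 + 25 * n) (hx : x ^ 12 = ε * w) {b : O}
    (hb : 5 * b = 1 + w + w ^ 2 + w ^ 3 + w ^ 4) : ∃ ι : 𝓞 K →+* O, ι α = x ∧ ι β = b := by
  have hεO : (ε : O) ^ 2 = 1 := by exact_mod_cast hε
  have hεw : (ε : O) * (ε * w) = w := by linear_combination w * hεO
  obtain ⟨ι, hι⟩ := NumberField.exists_ringHom_of_pow_eq (by norm_num) hirr hroot hgen (x := x) (by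
    rw [show x ^ 60 = (x ^ 12) ^ 5 by ring, hx, mul_pow, hw, hm]
    push_cast
    linear_combination ((ε : O) * (1 + 25 * n)) * (ε ^ 2 + 1) * hεO)
  refine ⟨ι, hι, mul_left_cancel₀ (by norm_num : (5 : O) ≠ 0) ?_⟩
  have h := congrArg ι hβ
  simp only [map_mul, map_add, map_pow, map_one, map_ofNat, map_intCast, hι, hx, hεw] at h
  rw [h, hb]

theorem exists_two_mul_eq {K : Type*} [Field K] [NumberField K] {δ : 𝓞 K} {n : ℤ}
    (h : δ ^ 2 = 1 + 4 * n) : ∃ β : 𝓞 K, 2 * β = 1 + δ := by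
  refine NumberField.RingOfIntegers.exists_mul_eq (d := 2) (by norm_num) _ fun b hb => ?_
  have h' := congrArg (algebraMap (𝓞 K) K) h
  simp only [map_add, map_pow, map_mul, map_one, map_ofNat, map_intCast, Nat.cast_ofNat] at hb h'
  generalize algebraMap (𝓞 K) K δ = e at hb h'
  refine ⟨X ^ 2 - X - C n, by monicity!, ?_⟩
  simp only [eval₂_sub, eval₂_pow, eval₂_X, eval₂_C]
  rw [eq_intCast]
  linear_combination (2 * b + e - 1) / 4 * hb + h' / 4

theorem exists_three_mul_eq {K : Type*} [Field K] [NumberField K] {δ : 𝓞 K} {n : ℤ}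
    (h : δ ^ 3 = 1 + 9 * n) : ∃ β : 𝓞 K, 3 * β = 1 + δ + δ ^ 2 := by
  refine NumberField.RingOfIntegers.exists_mul_eq (d := 3) (by norm_num) _ fun b hb => ?_
  have h' := congrArg (algebraMap (𝓞 K) K) h
  simp only [map_add, map_pow, map_mul, map_one, map_ofNat, map_intCast, Nat.cast_ofNat] at hb h'
  generalize algebraMap (𝓞 K) K δ = e at hb h'
  have hd : (e - 1) * b = 3 * n := by linear_combination (e - 1) / 3 * hb + h' / 3
  -- Put `δ - 1 = 3n / β` in `β = 1 + (δ - 1) + (δ - 1)² / 3` and clear denominators.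
  refine ⟨X ^ 3 - X ^ 2 - C (3 * n) * X - C (3 * n ^ 2), by monicity!, ?_⟩
  simp only [eval₂_sub, eval₂_mul, eval₂_pow, eval₂_X, eval₂_C]
  simp only [map_mul, map_pow, map_ofNat, eq_intCast]
  linear_combination b ^ 2 / 3 * hb + (b * (e - 1) + 3 * n + 3 * b) / 3 * hd

theorem exists_five_mul_eq {K : Type*} [Field K] [NumberField K] {δ : 𝓞 K} {n : ℤ}
    (h : δ ^ 5 = 1 + 25 * n) : ∃ β : 𝓞 K, 5 * β = 1 + δ + δ ^ 2 + δ ^ 3 + δ ^ 4 := by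
  refine NumberField.RingOfIntegers.exists_mul_eq (d := 5) (by norm_num) _ fun b hb => ?_
  have h' := congrArg (algebraMap (𝓞 K) K) h
  simp only [map_add, map_pow, map_mul, map_one, map_ofNat, map_intCast, Nat.cast_ofNat] at hb h'
  generalize algebraMap (𝓞 K) K δ = e at hb h'
  obtain ⟨d, rfl⟩ : ∃ d : K, e = 1 + d := ⟨e - 1, by ring⟩
  have hd : d * b = 5 * n := by linear_combination d / 5 * hb + h' / 5
  have e2 : d ^ 2 * b ^ 2 = 25 * n ^ 2 := by linear_combination (d * b + 5 * n) * hd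
  have e3 : d ^ 3 * b ^ 3 = 125 * n ^ 3 := by linear_combination d * b * e2 + 25 * n ^ 2 * hd
  have e4 : d ^ 4 * b ^ 4 = 625 * n ^ 4 := by linear_combination d * b * e3 + 125 * n ^ 3 * hd
  -- The same elimination, with `δ - 1 = 5n / β`.
  refine ⟨X ^ 5 - X ^ 4 - C (10 * n) * X ^ 3 - C (50 * n ^ 2) * X ^ 2 - C (125 * n ^ 3) * X -
    C (125 * n ^ 4), by monicity!, ?_⟩
  simp only [eval₂_sub, eval₂_mul, eval₂_pow, eval₂_X, eval₂_C]
  simp only [map_mul, map_pow, map_ofNat, eq_intCast]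
  linear_combination b ^ 4 / 5 * hb + e4 / 5 + b * e3 + 2 * b ^ 2 * e2 + 2 * b ^ 3 * hd

/-! ### Roots of `1 + p²n` in Witt vectors -/

/-- A monic polynomial congruent to `X ^ (N + 1) - X ^ N` modulo `p` has a root congruent to `1`. -/
theorem WittVector.exists_root_residue_one {p : ℕ} [Fact p.Prime] {k : Type*} [Field k] [CharP k p]
    [PerfectRing k p] (N : ℕ) (q : (WittVector p k)[X]) (hq : q.natDegree ≤ N) :
    ∃ y : WittVector p k, y ^ (N + 1) = y ^ N + p * q.eval y ∧ constantCoeff y = (1 : k) ∧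
      IsUnit y := by
  obtain ⟨y, hy, hy1⟩ := WittVector.exists_isRoot_of_simple_root (p := p) (k := k)
    (X ^ (N + 1) - (X ^ N + C (p : WittVector p k) * q))
    (monic_X_pow_sub ((degree_le_of_natDegree_le (natDegree_add_le_of_degree_le
      (natDegree_X_pow_le N) ((natDegree_C_mul_le _ _).trans hq))).trans_lt
        (by exact_mod_cast N.lt_succ_self))) 1
    (by
      simp only [Polynomial.map_sub, Polynomial.map_add, Polynomial.map_mul, Polynomial.map_pow,
        map_X, Polynomial.map_C, eval_sub, eval_add, eval_mul, eval_pow, eval_X, eval_C]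
      simp only [map_natCast, CharP.cast_eq_zero, zero_mul, one_pow, add_zero, sub_self])
    (by
      simp only [derivative_sub, derivative_add, derivative_X_pow, derivative_C_mul,
        Polynomial.map_sub, Polynomial.map_add, Polynomial.map_mul, Polynomial.map_pow, map_X,
        Polynomial.map_C, eval_sub, eval_add, eval_mul, eval_pow, eval_X, eval_C]
      simp only [map_natCast, CharP.cast_eq_zero, zero_mul, one_pow, add_zero, mul_one]
      push_cast
      simp)
  refine ⟨y, ?_, hy1, isUnit_of_coeff_zero_ne_zero y (by
    change constantCoeff y ≠ 0
    rw [hy1]; exact one_ne_zero)⟩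
  simpa [sub_eq_zero] using hy

/-- The equation for `z` is `z (1 + 3z + 3z²) = n`, which is not monic. The cofactor `y = 1 + 3z +
3z²` satisfies the monic equation found for `β`, so Hensel applies to `y`, and `z = n / y`. -/
theorem WittVector.exists_pow_three_eq (k : Type*) [Field k] [CharP k 3] [PerfectRing k 3]
    (n : ℤ) : ∃ z : WittVector 3 k, (1 + 3 * z) ^ 3 = 1 + 9 * n := by
  obtain ⟨y, hy, -, hu⟩ := WittVector.exists_root_residue_one (p := 3) (k := k) 2
    (C (n : WittVector 3 k) * X + C (n ^ 2 : WittVector 3 k)) (by compute_degree!)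
  obtain ⟨z, hz⟩ := hu.dvd (a := (n : WittVector 3 k))
  simp only [eval_add, eval_mul, eval_C, eval_X, Nat.cast_ofNat] at hy
  have h : 9 * z ^ 2 + 9 * z + 3 = 3 * y := by
    apply mul_left_cancel₀ (pow_ne_zero 2 hu.ne_zero)
    rw [hz] at hy
    linear_combination -3 * hy
  exact ⟨z, by linear_combination 3 * z * h - 9 * hz⟩

instance Nat.fact_prime_five : Fact (Nat.Prime 5) := ⟨by norm_num⟩

theorem WittVector.exists_pow_five_eq (k : Type*) [Field k] [CharP k 5] [PerfectRing k 5]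
    (n : ℤ) : ∃ z : WittVector 5 k, (1 + 5 * z) ^ 5 = 1 + 25 * n := by
  obtain ⟨y, hy, -, hu⟩ := WittVector.exists_root_residue_one (p := 5) (k := k) 4
    (C (2 * n : WittVector 5 k) * X ^ 3 + C (10 * n ^ 2 : WittVector 5 k) * X ^ 2 +
      C (25 * n ^ 3 : WittVector 5 k) * X + C (25 * n ^ 4 : WittVector 5 k)) (by compute_degree!)
  obtain ⟨z, hz⟩ := hu.dvd (a := (n : WittVector 5 k))
  simp only [eval_add, eval_mul, eval_pow, eval_C, eval_X, Nat.cast_ofNat] at hy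
  have h : (5 * z) ^ 4 + 5 * (5 * z) ^ 3 + 10 * (5 * z) ^ 2 + 10 * (5 * z) + 5 = 5 * y := by
    apply mul_left_cancel₀ (pow_ne_zero 4 hu.ne_zero)
    rw [hz] at hy
    linear_combination -5 * hy
  exact ⟨z, by linear_combination 5 * z * h - 25 * hz⟩

theorem WittVector.not_p_dvd_of_constantCoeff_ne_zero {p : ℕ} [Fact p.Prime] {k : Type*} [Field k]
    [CharP k p] {c : WittVector p k} (hc : WittVector.constantCoeff c ≠ (0 : k)) :
    ¬ (p : WittVector p k) ∣ c := by
  rintro ⟨d, rfl⟩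
  rw [map_mul, map_natCast, CharP.cast_eq_zero, zero_mul] at hc
  exact hc rfl

theorem WittVector.not_p_sq_dvd {p : ℕ} [Fact p.Prime] {k : Type*} [Field k]
    [CharP k p] [PerfectRing k p] {c : WittVector p k} (hc : WittVector.constantCoeff c ≠ (0 : k)) :
    ¬ (p : WittVector p k) ^ 2 ∣ p * c := by
  have := WittVector.charZero_of_charP p k
  rw [sq]
  intro h
  refine WittVector.not_p_dvd_of_constantCoeff_ne_zero hc ((mul_dvd_mul_iff_left ?_).1 h)
  exact Nat.cast_ne_zero.2 (Fact.out : p.Prime).ne_zero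

/-! ### Pairs of reductions at 3 and 5 -/

/-- The two reductions are obtained from embeddings into an unramified field and into its extension
by a cube root of unity. -/
theorem NumberField.exists_two_ringHoms_three {m n ε : ℤ} (hε : ε ^ 2 = 1)
    (hm : m = ε * (1 + 9 * n)) (hirr : Irreducible (X ^ 60 - C (m : ℚ)))
    {K : Type*} [Field K] [NumberField K] {α β : 𝓞 K} (hroot : α ^ 60 = m)
    (hgen : IntermediateField.adjoin ℚ {(α : K)} = ⊤)
    (hβ : 3 * β = 1 + ε * α ^ 20 + (ε * α ^ 20) ^ 2)
    {k : Type*} [Field k] [CharP k 3] [PerfectRing k 3] {a : k} (ha0 : a ≠ 0) (ha : a ^ 20 = ε) :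
    ∃ φ₁ φ₂ : 𝓞 K →+* k, φ₁ α = a ∧ φ₂ α = a ∧ φ₁ β ≠ φ₂ β := by
  have h3 : (3 : k) = 0 := by exact_mod_cast CharP.cast_eq_zero k 3
  have := WittVector.charZero_of_charP 3 k
  obtain ⟨z, hz⟩ := WittVector.exists_pow_three_eq k n
  obtain ⟨v, hv, hva⟩ := WittVector.exists_pow_eq (p := 3) (N := 20) (k := k)
    (by rw [Ne, CharP.cast_eq_zero_iff k 3]; norm_num) (ε * (1 + 3 * z)) ha0
    (by simp only [map_mul, map_add, map_one, map_ofNat, map_intCast, h3]; rw [ha]; ring)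
  obtain ⟨ι₁, hα₁, hβ₁⟩ := IsIntegrallyClosed.exists_ringHom_three hε hm hirr hroot hgen hβ hz hv
    (b := 1 + 3 * z + 3 * z ^ 2) (by ring)
  -- This polynomial is `((X + 1)³ - 1) / X`, so `1 + ϖ` is a cube root of unity.
  have hdeg : (X ^ 2 + C (3 : WittVector 3 k) * X + C (3 : WittVector 3 k)).natDegree = 2 := by
    compute_degree!
  have hc0 : (X ^ 2 + C (3 : WittVector 3 k) * X + C (3 : WittVector 3 k)).coeff 0 = 3 * 1 := by
    simp [coeff_X]
  obtain ⟨O, _, _, _, _, i, r, ϖ, hϖ, hrϖ, hri⟩ := WittVector.exists_eisenstein_extension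
    (X ^ 2 + C (3 : WittVector 3 k) * X + C (3 : WittVector 3 k)) (by monicity!)
    (by rw [hdeg]; norm_num)
    (by
      rw [hdeg]
      intro j hj
      interval_cases j <;> simp [coeff_X])
    (by
      rw [hc0]
      exact WittVector.not_p_sq_dvd (p := 3) (by rw [map_one]; exact one_ne_zero))
  simp only [eval₂_add, eval₂_mul, eval₂_pow, eval₂_X, eval₂_C] at hϖ
  simp only [map_ofNat] at hϖ
  have hζ : (1 + ϖ) ^ 3 = 1 := by linear_combination ϖ * hϖ
  have hzO := congrArg i hz
  have hvO := congrArg i hv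
  simp only [map_mul, map_add, map_one, map_pow, map_ofNat, map_intCast] at hzO hvO
  have hs : 1 + (1 + ϖ) + (1 + ϖ) ^ 2 = 0 := by linear_combination hϖ
  generalize hζdef : 1 + ϖ = ζ at hζ hs
  have hrζ : r ζ = 1 := by rw [← hζdef, map_add, hrϖ, map_one, add_zero]
  obtain ⟨ι₂, hα₂, hβ₂⟩ := IsIntegrallyClosed.exists_ringHom_three hε hm hirr hroot hgen hβ
    -- The exponent 2 is the inverse of 20 modulo 3.
    (x := i v * ζ ^ 2) (w := (1 + 3 * i z) * ζ) (by rw [mul_pow, hzO, hζ, mul_one])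
    (by
      rw [mul_pow, hvO, ← pow_mul, show ζ ^ (2 * 20) = (ζ ^ 3) ^ 13 * ζ by ring, hζ]
      ring)
    -- Subtract `1 + ζ + ζ² = 0` from `1 + w + w²` and divide by 3. As `ζ ↦ 1`, the residue is `3z +
    -- 3z² = 0`, against 1 for `ι₁`.
    (b := i z * ζ + (2 * i z + 3 * i z ^ 2) * ζ ^ 2)
    (by linear_combination -hs)
  refine ⟨WittVector.constantCoeff.comp ι₁, r.comp ι₂, ?_, ?_, ?_⟩
  · simp only [RingHom.comp_apply, hα₁, hva]
  · simp only [RingHom.comp_apply, hα₂, map_mul, map_pow, hrζ, hri, hva, one_pow, mul_one]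
  · simp only [RingHom.comp_apply, hβ₁, hβ₂, map_mul, map_add, map_pow, map_one, map_ofNat, hrζ,
      hri]
    intro h
    refine one_ne_zero (α := k) ?_
    linear_combination h

theorem NumberField.exists_two_ringHoms_five {m n ε : ℤ} (hε : ε ^ 2 = 1)
    (hm : m = ε * (1 + 25 * n)) (hirr : Irreducible (X ^ 60 - C (m : ℚ)))
    {K : Type*} [Field K] [NumberField K] {α β : 𝓞 K} (hroot : α ^ 60 = m)
    (hgen : IntermediateField.adjoin ℚ {(α : K)} = ⊤)
    (hβ : 5 * β = 1 + ε * α ^ 12 + (ε * α ^ 12) ^ 2 + (ε * α ^ 12) ^ 3 + (ε * α ^ 12) ^ 4)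
    {k : Type*} [Field k] [CharP k 5] [PerfectRing k 5] {a : k} (ha0 : a ≠ 0) (ha : a ^ 12 = ε) :
    ∃ φ₁ φ₂ : 𝓞 K →+* k, φ₁ α = a ∧ φ₂ α = a ∧ φ₁ β ≠ φ₂ β := by
  have h5 : (5 : k) = 0 := by exact_mod_cast CharP.cast_eq_zero k 5
  have := WittVector.charZero_of_charP 5 k
  obtain ⟨z, hz⟩ := WittVector.exists_pow_five_eq k n
  obtain ⟨v, hv, hva⟩ := WittVector.exists_pow_eq (p := 5) (N := 12) (k := k)
    (by rw [Ne, CharP.cast_eq_zero_iff k 5]; norm_num) (ε * (1 + 5 * z)) ha0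
    (by simp only [map_mul, map_add, map_one, map_ofNat, map_intCast, h5]; rw [ha]; ring)
  obtain ⟨ι₁, hα₁, hβ₁⟩ := IsIntegrallyClosed.exists_ringHom_five hε hm hirr hroot hgen hβ hz hv
    (b := 1 + 10 * z + 50 * z ^ 2 + 125 * z ^ 3 + 125 * z ^ 4) (by ring)
  -- Here `g = ((X + 1)⁵ - 1) / X`.
  set g : (WittVector 5 k)[X] := X ^ 4 + C (5 : WittVector 5 k) * X ^ 3 +
    C (10 : WittVector 5 k) * X ^ 2 + C (10 : WittVector 5 k) * X + C (5 : WittVector 5 k) with hg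
  have hdeg : g.natDegree = 4 := by
    rw [hg]; compute_degree!
  have hc0 : g.coeff 0 = 5 * 1 := by
    simp [hg, coeff_X]
  obtain ⟨O, _, _, _, _, i, r, ϖ, hϖ, hrϖ, hri⟩ := WittVector.exists_eisenstein_extension
    g (by rw [hg]; monicity!)
    (by rw [hdeg]; norm_num)
    (by
      rw [hdeg]
      intro j hj
      have h10 : (5 : WittVector 5 k) ∣ 10 := ⟨2, by norm_num⟩
      interval_cases j <;> simp [hg, coeff_X, coeff_X_pow, h10])
    (by
      rw [hc0]
      exact WittVector.not_p_sq_dvd (p := 5) (by rw [map_one]; exact one_ne_zero))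
  simp only [hg, eval₂_add, eval₂_mul, eval₂_pow, eval₂_X, eval₂_C] at hϖ
  simp only [map_ofNat] at hϖ
  have hζ : (1 + ϖ) ^ 5 = 1 := by linear_combination ϖ * hϖ
  have hzO := congrArg i hz
  have hvO := congrArg i hv
  simp only [map_mul, map_add, map_one, map_pow, map_ofNat, map_intCast] at hzO hvO
  have hs : 1 + (1 + ϖ) + (1 + ϖ) ^ 2 + (1 + ϖ) ^ 3 + (1 + ϖ) ^ 4 = 0 := by
    linear_combination hϖ
  generalize hζdef : 1 + ϖ = ζ at hζ hs
  have hrζ : r ζ = 1 := by rw [← hζdef, map_add, hrϖ, map_one, add_zero]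
  obtain ⟨ι₂, hα₂, hβ₂⟩ := IsIntegrallyClosed.exists_ringHom_five hε hm hirr hroot hgen hβ
    -- The exponent 3 is the inverse of 12 modulo 5.
    (x := i v * ζ ^ 3) (w := (1 + 5 * i z) * ζ) (by rw [mul_pow, hzO, hζ, mul_one])
    (by
      rw [mul_pow, hvO, ← pow_mul, show ζ ^ (3 * 12) = (ζ ^ 5) ^ 7 * ζ by ring, hζ]
      ring)
    (b := i z * ζ + (2 * i z + 5 * i z ^ 2) * ζ ^ 2 +
      (3 * i z + 15 * i z ^ 2 + 25 * i z ^ 3) * ζ ^ 3 +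
      (4 * i z + 30 * i z ^ 2 + 100 * i z ^ 3 + 125 * i z ^ 4) * ζ ^ 4)
    (by linear_combination -hs)
  refine ⟨WittVector.constantCoeff.comp ι₁, r.comp ι₂, ?_, ?_, ?_⟩
  · simp only [RingHom.comp_apply, hα₁, hva]
  · simp only [RingHom.comp_apply, hα₂, map_mul, map_pow, hrζ, hri, hva, one_pow, mul_one]
  · simp only [RingHom.comp_apply, hβ₁, hβ₂, map_mul, map_add, map_pow, map_one, map_ofNat, hrζ,
      hri]
    intro h
    refine one_ne_zero (α := k) ?_
    linear_combination h

/-! ### Reductions at 2 -/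

/-- If `m = 1 + 4c`, each 15-th root of unity `a` of `k` and each root `b ∈ k` of
`b² - b = c` come from a reduction `𝓞 K → k` sending `α` to `a` and `(1 + α³⁰) / 2` to `b`. -/
theorem NumberField.exists_ringHom_two {m c : ℤ}
    (hm : m = 1 + 4 * c) (hirr : Irreducible (X ^ 60 - C (m : ℚ)))
    {K : Type*} [Field K] [NumberField K] {α β : 𝓞 K} (hroot : α ^ 60 = m)
    (hgen : IntermediateField.adjoin ℚ {(α : K)} = ⊤) (hβ : 2 * β = 1 + α ^ 30)
    {k : Type*} [Field k] [CharP k 2] [PerfectRing k 2]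
    (hAS : ∀ e : ℤ, ∃ b : k, b ^ 2 - b = e) {a b : k} (ha : a ^ 15 = 1) (hb : b ^ 2 - b = c) :
    ∃ φ : 𝓞 K →+* k, φ α = a ∧ φ β = b := by
  have h2 : (2 : k) = 0 := by exact_mod_cast CharP.cast_eq_zero k 2
  have hneg : (-1 : k) = 1 := by linear_combination -h2
  have h15 : ((15 : ℕ) : k) ≠ 0 := by rw [Ne, CharP.cast_eq_zero_iff k 2]; norm_num
  have hchar := WittVector.charZero_of_charP 2 k
  have hW2 : (2 : WittVector 2 k) ≠ 0 := by norm_num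
  have hdvd {x : WittVector 2 k} (hx : WittVector.constantCoeff x = (0 : k)) : ∃ y, x = 2 * y := by
    obtain ⟨y, hy⟩ := Ideal.mem_span_singleton.1 ((mem_span_p_iff_coeff_zero_eq_zero x).2 hx)
    exact ⟨y, by exact_mod_cast hy⟩
  have hquad (e : WittVector 2 k) (b : k) (hb : b ^ 2 - b = WittVector.constantCoeff e) :
      ∃ y, y ^ 2 - y = e ∧ WittVector.constantCoeff y = b := by
    obtain ⟨y, hy, hyb⟩ := WittVector.exists_isRoot_of_simple_root (X ^ 2 - X - C e)
      (by monicity!) b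
      (by simp only [Polynomial.map_sub, Polynomial.map_pow, map_X, Polynomial.map_C, eval_sub,
            eval_pow, eval_X, eval_C, hb, sub_self])
      (by
        simp only [derivative_sub, derivative_X_pow, derivative_X, derivative_C, sub_zero,
          Polynomial.map_sub, Polynomial.map_mul, Polynomial.map_pow, map_X, Polynomial.map_C,
          Polynomial.map_one, eval_sub, eval_mul, eval_pow, eval_X, eval_C, eval_one]
        rw [map_natCast, CharP.cast_eq_zero, zero_mul, zero_sub]
        exact neg_ne_zero.2 one_ne_zero)
    exact ⟨y, by simpa [sub_eq_zero] using hy, hyb⟩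
  obtain ⟨t, ht, hta⟩ := WittVector.exists_pow_eq (p := 2) h15 1
    (a := a) (by rintro rfl; norm_num at ha) (by rw [ha, map_one])
  obtain ⟨u, hu, hu1⟩ := WittVector.exists_pow_eq (p := 2) h15 (m : WittVector 2 k)
    (a := (1 : k)) one_ne_zero (by
      rw [map_intCast, hm]; push_cast; linear_combination (-2 * c : k) * h2)
  obtain ⟨q, hq⟩ := hdvd (x := u - 1) (by rw [map_sub, hu1, map_one, sub_self])
  -- Since `u` is odd, `u² ≡ 1` modulo 4; then `u = u¹⁵ / (u²)⁷ ≡ 1` modulo 4.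
  obtain ⟨d, hd⟩ : ∃ d, u = 1 + 4 * d := by
    obtain ⟨s, hs⟩ : u ^ 2 - 1 ∣ (u ^ 2) ^ 7 - 1 := sub_one_dvd_pow_sub_one _ _
    have hu2 : u ^ 2 - 1 = 4 * (q + q ^ 2) := by linear_combination (u + 1 + 2 * q) * hq
    rw [hu2] at hs
    rw [hm] at hu
    push_cast at hu
    exact ⟨c - u * (q + q ^ 2) * s, by linear_combination hu - u * hs⟩
  -- From `(1 + 4d)¹⁵ = 1 + 4c`. Precision modulo 4 is kept because the case `b = 1` divides this
  -- relation by 2.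
  obtain ⟨κ, hκ⟩ : ∃ κ, (c : WittVector 2 k) = 15 * d + 4 * κ := by
    obtain ⟨κ, hκ⟩ := Polynomial.powAddExpansion (1 : WittVector 2 k) (4 * d) 15
    rw [← hd, hu, hm] at hκ
    push_cast at hκ
    refine ⟨κ * d ^ 2, mul_left_cancel₀ (by norm_num : (4 : WittVector 2 k) ≠ 0) ?_⟩
    linear_combination hκ
  have hcd : (c : k) = WittVector.constantCoeff d := by
    have := congrArg WittVector.constantCoeff hκ
    simp only [map_intCast, map_add, map_mul, map_ofNat] at this
    linear_combination this + (7 * WittVector.constantCoeff d + 2 * WittVector.constantCoeff κ) * h2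
  obtain ⟨y, hy, hyb⟩ := hquad d b (by rw [hb, hcd])
  have hsu : (2 * y - 1) ^ 2 = u := by linear_combination 4 * hy - hd
  -- A square root of `2y - 1` gives the desired homomorphism.
  have key {O : Type _} [CommRing O] [IsDomain O] [IsIntegrallyClosed O] [CharZero O]
      (i : WittVector 2 k →+* O) (r : O →+* k) (hri : ∀ w, r (i w) = WittVector.constantCoeff w)
      (x : O) (hx : x ^ 2 = i (2 * y - 1)) (hrx : r x = 1) :
      ∃ φ : 𝓞 K →+* k, φ α = a ∧ φ β = b := by
    have hx60 : (i t * x) ^ 60 = m := by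
      rw [mul_pow, show x ^ 60 = ((x ^ 2) ^ 2) ^ 15 by ring, hx, ← map_pow, ← map_pow, ← map_pow,
        hsu, hu, show t ^ 60 = (t ^ 15) ^ 4 by ring, ht, one_pow, map_one, one_mul, map_intCast]
    obtain ⟨ι, hι⟩ := NumberField.exists_ringHom_of_pow_eq (by norm_num) hirr hroot hgen hx60
    obtain ⟨τ, hτ⟩ : ∃ τ, u ^ 7 = 1 + 4 * τ := by
      obtain ⟨s, hs⟩ : u - 1 ∣ u ^ 7 - 1 := sub_one_dvd_pow_sub_one _ _
      exact ⟨d * s, by rw [hd] at hs ⊢; linear_combination hs⟩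
    have hιβ : ι β = i (y + 2 * (2 * y - 1) * τ) := by
      apply mul_left_cancel₀ (by norm_num : (2 : O) ≠ 0)
      have h := congrArg ι hβ
      simp only [map_mul, map_add, map_one, map_pow, map_ofNat, hι] at h
      rw [h, mul_pow, show x ^ 30 = (x ^ 2) ^ 15 by ring, hx, ← map_pow, ← map_pow,
        show t ^ 30 = (t ^ 15) ^ 2 by ring, ht, one_pow, map_one, one_mul,
        show (2 * y - 1) ^ 15 = ((2 * y - 1) ^ 2) ^ 7 * (2 * y - 1) by ring, hsu, hτ]
      simp only [map_mul, map_add, map_sub, map_one, map_ofNat]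
      ring
    refine ⟨r.comp ι, ?_, ?_⟩
    · rw [RingHom.comp_apply, hι, map_mul, hri, hta, hrx, mul_one]
    · rw [RingHom.comp_apply, hιβ, hri]
      simp only [map_mul, map_add, map_sub, map_one, map_ofNat, hyb, h2]
      ring
  -- If `b = 1`, then `2y - 1 = 1 + 4j` has a square root in `W(k)` once `g² - g = j` is solvable;
  -- the residue of `j` is an integer, so `hAS` applies. Otherwise `1 - y` is a unit, and the
  -- polynomial of `1 - √(2y - 1)` is Eisenstein.
  by_cases hb1 : b = 1
  · subst hb1
    obtain ⟨j, hj⟩ := hdvd (x := y - 1) (by rw [map_sub, hyb, map_one, sub_self])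
    obtain ⟨c', rfl⟩ : (2 : ℤ) ∣ c := by
      exact_mod_cast (CharP.intCast_eq_zero_iff k 2 c).1 (by rw [← hb]; ring)
    have hj' : WittVector.constantCoeff j = (c' : k) := by
      have h : (c' : WittVector 2 k) = 15 * j * (1 + 2 * j) + 2 * κ := by
        apply mul_left_cancel₀ hW2
        push_cast at hκ
        linear_combination hκ - 15 * hy + 15 * (y + 2 * j) * hj
      have := congrArg WittVector.constantCoeff h
      simp only [map_intCast, map_add, map_mul, map_one, map_ofNat] at this
      linear_combination -this -
        (7 * WittVector.constantCoeff j + 15 * WittVector.constantCoeff j ^ 2 + WittVector.constantCoeff κ) * h2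
    obtain ⟨e, he⟩ := hAS c'
    obtain ⟨g, hg, -⟩ := hquad j e (by rw [he, hj'])
    refine key (RingHom.id _) WittVector.constantCoeff (fun _ => rfl) (2 * g - 1) ?_ ?_
    · rw [RingHom.id_apply]
      linear_combination 4 * hg - 2 * hj
    · rw [map_sub, map_mul, map_ofNat, h2, map_one]
      linear_combination hneg
  · set f : (WittVector 2 k)[X] := X ^ 2 - C 2 * X + C (2 * (1 - y)) with hf
    have hdeg : f.natDegree = 2 := by rw [hf]; compute_degree!
    have hc0 : f.coeff 0 = 2 * (1 - y) := by simp [hf, coeff_X]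
    obtain ⟨O, _, _, _, _, i, r, ϖ, hϖ, hrϖ, hri⟩ := WittVector.exists_eisenstein_extension
      f (by rw [hf]; monicity!) (by rw [hdeg]; norm_num)
      (by
        rw [hdeg]
        intro j hj
        interval_cases j
        · rw [hc0]; exact dvd_mul_right _ _
        · simp [hf, coeff_one])
      (by
        rw [hc0]
        refine WittVector.not_p_sq_dvd (p := 2) ?_
        rw [map_sub, map_one, hyb, sub_ne_zero]
        exact fun h => hb1 h.symm)
    simp only [hf, eval₂_add, eval₂_sub, eval₂_mul, eval₂_pow, eval₂_X, eval₂_C] at hϖ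
    simp only [map_mul, map_sub, map_one, map_ofNat] at hϖ
    refine key i r hri (1 - ϖ) ?_ ?_
    · simp only [map_mul, map_sub, map_one, map_ofNat]
      linear_combination hϖ
    · rw [map_sub, map_one, hrϖ, sub_zero]

/-! ### Counting in finite fields -/

/-- In the field with `p²` elements at least half of the nonzero elements have `N`-th power `-1`,
if `N` is an odd multiple of `(p² - 1) / 2`. -/
theorem FiniteField.card_pow_eq_neg_one {k : Type*} [Field k] [Fintype k] [DecidableEq k]
    {h N j : ℕ} (hcard : Fintype.card k = 2 * h + 1) (h0 : 0 < h) (hN : N = h * (2 * j + 1)) :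
    h ≤ (Finset.univ.filter fun a : k => a ^ N = -1).card := by
  -- Nonzero `a` satisfy `a ^ h = ±1`, and at most `h` of them have `a ^ h = 1`.
  have hsub : (Finset.univ : Finset k) ⊆
      insert 0 ((nthRoots h (1 : k)).toFinset ∪ Finset.univ.filter fun a : k => a ^ N = -1) := by
    intro a _
    by_cases ha : a = 0
    · simp [ha]
    have h1 : a ^ (2 * h) = 1 := by
      rw [← FiniteField.pow_card_sub_one_eq_one a ha, hcard, Nat.add_sub_cancel]
    have h2 : (a ^ h - 1) * (a ^ h + 1) = 0 := by
      rw [mul_comm, pow_mul] at h1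
      linear_combination h1
    rw [Finset.mem_insert, Finset.mem_union, Multiset.mem_toFinset, mem_nthRoots h0]
    rcases mul_eq_zero.1 h2 with h3 | h3
    · exact Or.inr (Or.inl (sub_eq_zero.1 h3))
    · refine Or.inr (Or.inr ?_)
      rw [Finset.mem_filter, hN, pow_mul, eq_neg_of_add_eq_zero_left h3]
      exact ⟨Finset.mem_univ _, Odd.neg_one_pow ⟨j, rfl⟩⟩
  have hle := Finset.card_le_card hsub
  have h1 := Finset.card_insert_le (0 : k)
    ((nthRoots h (1 : k)).toFinset ∪ Finset.univ.filter fun a : k => a ^ N = -1)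
  have h2 := Finset.card_union_le (nthRoots h (1 : k)).toFinset
    (Finset.univ.filter fun a : k => a ^ N = -1)
  have h3 := (Multiset.toFinset_card_le (nthRoots h (1 : k))).trans (card_nthRoots h 1)
  rw [Finset.card_univ, hcard] at hle
  omega

theorem FiniteField.card_pow_char_ne_le {k : Type*} [Field k] [Fintype k] [DecidableEq k] (p : ℕ)
    [Fact p.Prime] [CharP k p] :
    (Finset.univ.filter fun b : k => b ^ p ≠ b).card + p ≤ Fintype.card k := by
  let f : ZMod p →+* k := ZMod.castHom dvd_rfl k
  have hp : (Finset.univ.image f).card = p := by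
    rw [Finset.card_image_of_injective _ f.injective, Finset.card_univ, ZMod.card]
  have hsub : Finset.univ.image f ⊆ Finset.univ.filter fun b : k => b ^ p = b := by
    intro b hb
    obtain ⟨c, -, rfl⟩ := Finset.mem_image.1 hb
    rw [Finset.mem_filter, ← map_pow, ZMod.pow_card]
    exact ⟨Finset.mem_univ _, rfl⟩
  have h1 := Finset.card_le_card hsub
  have h2 := Finset.card_filter_add_card_filter_not (s := Finset.univ) fun b : k => b ^ p = b
  rw [Finset.card_univ] at h2
  rw [hp] at h1
  simp only [ne_eq]
  omega

/-- Non-monogenicity from two reductions over each nonzero element of `𝔽_p`. -/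
theorem not_isMonogenicField_of_zmod {K : Type*} [Field K] [NumberField K] {α β : 𝓞 K} (p : ℕ)
    [Fact p.Prime] (hp : 2 < p)
    (h : ∀ a : ZMod p, a ≠ 0 →
      ∃ φ₁ φ₂ : 𝓞 K →+* ZMod p, φ₁ α = a ∧ φ₂ α = a ∧ φ₁ β ≠ φ₂ β) :
    ¬ IsMonogenicField K := by
  refine not_isMonogenicField_of_ringHoms (Finset.univ.erase (0 : ZMod p)) Finset.univ ?_ α β
    (fun _ _ _ _ => Finset.mem_univ _) fun a ha => h a (Finset.ne_of_mem_erase ha)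
  rw [Finset.card_erase_of_mem (Finset.mem_univ _), Finset.card_univ, ZMod.card]
  omega

/-- Non-monogenicity from two reductions over each `N`-th root of `-1` in `𝔽_{p²}`. -/
theorem not_isMonogenicField_of_galoisField {K : Type*} [Field K] [NumberField K] {α β : 𝓞 K}
    (p : ℕ) [Fact p.Prime] {h N j : ℕ} (hp2 : 2 < p) (hp : p ^ 2 = 2 * h + 1)
    (hN : N = h * (2 * j + 1)) (hpN : ∀ a : GaloisField p 2, a ^ N = -1 → a ^ p ≠ a)
    (hφ : ∀ a : GaloisField p 2, a ^ N = -1 →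
      ∃ φ₁ φ₂ : 𝓞 K →+* GaloisField p 2, φ₁ α = a ∧ φ₂ α = a ∧ φ₁ β ≠ φ₂ β) :
    ¬ IsMonogenicField K := by
  classical
  have := Fintype.ofFinite (GaloisField p 2)
  have hcard : Fintype.card (GaloisField p 2) = 2 * h + 1 := by
    rw [← Nat.card_eq_fintype_card, GaloisField.card p 2 two_ne_zero, hp]
  have hA := FiniteField.card_pow_eq_neg_one hcard (by nlinarith) hN
  have hB := FiniteField.card_pow_char_ne_le (k := GaloisField p 2) p
  -- The count is `|B| ≤ p² - p < p² - 1 = 2h ≤ 2|A|`.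
  refine not_isMonogenicField_of_ringHoms
    (Finset.univ.filter fun a : GaloisField p 2 => a ^ N = -1)
    (Finset.univ.filter fun b : GaloisField p 2 => b ^ p ≠ b) (by omega) α β ?_ ?_
  · intro φ θ hθ hx
    exact Finset.mem_filter.2 ⟨Finset.mem_univ _,
      pow_char_ne_of_adjoin_eq_top φ hθ (hpN _ (Finset.mem_filter.1 hx).2)⟩
  · exact fun a ha => hφ a (Finset.mem_filter.1 ha).2

/-! ### The congruence cases -/

theorem not_isMonogenicField_of_modEq_nine {m ε : ℤ} (hε : ε = 1 ∨ ε = -1)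
    (hm : m ≡ ε [ZMOD 9]) (hirr : Irreducible (X ^ 60 - C (m : ℚ)))
    {K : Type*} [Field K] [NumberField K] {α : 𝓞 K} (hroot : α ^ 60 = m)
    (hgen : IntermediateField.adjoin ℚ {(α : K)} = ⊤) : ¬ IsMonogenicField K := by
  have hε2 : ε ^ 2 = 1 := by rcases hε with rfl | rfl <;> norm_num
  obtain ⟨n, hn⟩ := hm.symm.dvd
  have hm' : m = ε * (1 + 9 * (ε * n)) := by linear_combination hn - 9 * n * hε2
  obtain ⟨β, hβ⟩ := exists_three_mul_eq (δ := (ε : 𝓞 K) * α ^ 20) (n := ε * n) (by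
    have hεK : (ε : 𝓞 K) ^ 2 = 1 := by exact_mod_cast hε2
    rw [mul_pow, ← pow_mul, hroot, hm']
    push_cast
    linear_combination (1 + 9 * (ε * n : 𝓞 K)) * (ε ^ 2 + 1) * hεK)
  have key {k : Type} [Field k] [CharP k 3] [PerfectRing k 3] {a : k} (ha0 : a ≠ 0) :=
    NumberField.exists_two_ringHoms_three hε2 hm' hirr hroot hgen hβ (k := k) ha0
  rcases hε with rfl | rfl
  · refine not_isMonogenicField_of_zmod (α := α) (β := β) 3 (by norm_num) fun a ha => key ha ?_
    revert a; decide
  · refine not_isMonogenicField_of_galoisField (α := α) (β := β) 3 (h := 4) (N := 20) (j := 2)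
      (by norm_num) (by norm_num) (by norm_num) ?_ ?_
    -- A nonzero `a` in the prime field has `a² = 1`, so `a²⁰` would be 1.
    · intro a ha h
      have ha0 : a ≠ 0 := by rintro rfl; norm_num at ha
      have h2 : a ^ 2 = 1 := mul_left_cancel₀ ha0 (by linear_combination h)
      have h1 : (1 : GaloisField 3 2) = -1 := by
        rw [← ha, show a ^ 20 = (a ^ 2) ^ 10 by ring, h2, one_pow]
      have h3 : (3 : GaloisField 3 2) = 0 := by
        exact_mod_cast CharP.cast_eq_zero (GaloisField 3 2) 3
      exact one_ne_zero (α := GaloisField 3 2) (by linear_combination h3 - h1)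
    · intro a ha
      exact key (by rintro rfl; norm_num at ha) (by rw [ha]; push_cast; rfl)

theorem not_isMonogenicField_of_modEq_twentyFive {m ε : ℤ} (hε : ε = 1 ∨ ε = -1)
    (hm : m ≡ ε [ZMOD 25]) (hirr : Irreducible (X ^ 60 - C (m : ℚ)))
    {K : Type*} [Field K] [NumberField K] {α : 𝓞 K} (hroot : α ^ 60 = m)
    (hgen : IntermediateField.adjoin ℚ {(α : K)} = ⊤) : ¬ IsMonogenicField K := by
  have hε2 : ε ^ 2 = 1 := by rcases hε with rfl | rfl <;> norm_num
  obtain ⟨n, hn⟩ := hm.symm.dvd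
  have hm' : m = ε * (1 + 25 * (ε * n)) := by linear_combination hn - 25 * n * hε2
  obtain ⟨β, hβ⟩ := exists_five_mul_eq (δ := (ε : 𝓞 K) * α ^ 12) (n := ε * n) (by
    have hεK : (ε : 𝓞 K) ^ 2 = 1 := by exact_mod_cast hε2
    rw [mul_pow, ← pow_mul, hroot, hm']
    push_cast
    linear_combination (1 + 25 * (ε * n : 𝓞 K)) * (ε ^ 4 + ε ^ 2 + 1) * hεK)
  have key {k : Type} [Field k] [CharP k 5] [PerfectRing k 5] {a : k} (ha0 : a ≠ 0) :=
    NumberField.exists_two_ringHoms_five hε2 hm' hirr hroot hgen hβ (k := k) ha0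
  rcases hε with rfl | rfl
  · refine not_isMonogenicField_of_zmod (α := α) (β := β) 5 (by norm_num) fun a ha => key ha ?_
    revert a; decide
  · refine not_isMonogenicField_of_galoisField (α := α) (β := β) 5 (h := 12) (N := 12) (j := 0)
      (by norm_num) (by norm_num) (by norm_num) ?_ ?_
    · intro a ha h
      have ha0 : a ≠ 0 := by rintro rfl; norm_num at ha
      have h2 : a ^ 4 = 1 := mul_left_cancel₀ ha0 (by linear_combination h)
      have h1 : (1 : GaloisField 5 2) = -1 := by
        rw [← ha, show a ^ 12 = (a ^ 4) ^ 3 by ring, h2, one_pow]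
      have h3 : (5 : GaloisField 5 2) = 0 := by
        exact_mod_cast CharP.cast_eq_zero (GaloisField 5 2) 5
      exact one_ne_zero (α := GaloisField 5 2) (by linear_combination h3 - 2 * h1)
    · intro a ha
      exact key (by rintro rfl; norm_num at ha) (by rw [ha]; push_cast; rfl)

theorem not_isMonogenicField_of_modEq_four {m : ℤ} (hm : m ≡ 1 [ZMOD 4])
    (hirr : Irreducible (X ^ 60 - C (m : ℚ)))
    {K : Type*} [Field K] [NumberField K] {α : 𝓞 K} (hroot : α ^ 60 = m)
    (hgen : IntermediateField.adjoin ℚ {(α : K)} = ⊤) : ¬ IsMonogenicField K := by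
  classical
  obtain ⟨c, hc⟩ := hm.symm.dvd
  have hm' : m = 1 + 4 * c := by linear_combination hc
  obtain ⟨β, hβ⟩ := exists_two_mul_eq (δ := α ^ 30) (n := c) (by
    rw [← pow_mul, hroot, hm']; push_cast; ring)
  have := Fintype.ofFinite (GaloisField 2 2)
  have h2 : (2 : GaloisField 2 2) = 0 := by
    exact_mod_cast CharP.cast_eq_zero (GaloisField 2 2) 2
  have hcard : Fintype.card (GaloisField 2 2) = 4 := by
    rw [← Nat.card_eq_fintype_card, GaloisField.card 2 2 two_ne_zero]; norm_num
  have hfour (a : GaloisField 2 2) : a ^ 4 = a := hcard ▸ FiniteField.pow_card a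
  obtain ⟨w, hw⟩ : ∃ w : GaloisField 2 2, w ^ 2 ≠ w := by
    by_contra! h
    have h1 := Finset.card_le_card (s := (Finset.univ : Finset (GaloisField 2 2)))
      (t := {(0 : GaloisField 2 2), 1}) fun a _ => by
      have : a * (a - 1) = 0 := by linear_combination h a
      rcases mul_eq_zero.1 this with h | h
      · simp [h]
      · simp [sub_eq_zero.1 h]
    have h2 := h1.trans Finset.card_le_two
    rw [Finset.card_univ, hcard] at h2
    norm_num at h2
  have hw1 : w ^ 2 - w = 1 := by
    have : (w ^ 2 - w) * (w ^ 2 - w - 1) = 0 := by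
      linear_combination hfour w + (w - w ^ 3) * h2
    exact sub_eq_zero.1 ((mul_eq_zero.1 this).resolve_left (sub_ne_zero.2 hw))
  -- This needs `𝔽₄`: over `𝔽₂` the equation `b² - b = 1` has no root.
  have hAS (e : ℤ) : ∃ b : GaloisField 2 2, b ^ 2 - b = e := by
    rcases Int.even_or_odd' e with ⟨d, rfl | rfl⟩
    · exact ⟨0, by push_cast; linear_combination -d * h2⟩
    · exact ⟨w, by push_cast; linear_combination hw1 - d * h2⟩
  obtain ⟨b, hb⟩ := hAS c
  set A := Finset.univ.filter fun a : GaloisField 2 2 => a ^ 2 ≠ a with hA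
  have hA0 : 0 < A.card := Finset.card_pos.2 ⟨w, Finset.mem_filter.2 ⟨Finset.mem_univ _, hw⟩⟩
  -- Both `α` and `θ` take values in `𝔽₄ \ 𝔽₂`, so the inequality is just `|A| < 2|A|`.
  refine not_isMonogenicField_of_ringHoms A A (by omega) α β ?_ ?_
  · intro φ θ hθ hx
    exact Finset.mem_filter.2 ⟨Finset.mem_univ _,
      pow_char_ne_of_adjoin_eq_top φ hθ (Finset.mem_filter.1 hx).2⟩
  · intro a ha
    have ha0 : a ≠ 0 := by rintro rfl; simp [hA] at ha
    have ha3 : a ^ 3 = 1 := mul_left_cancel₀ ha0 (by linear_combination hfour a)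
    have ha15 : a ^ 15 = 1 := by rw [show a ^ 15 = (a ^ 3) ^ 5 by ring, ha3, one_pow]
    obtain ⟨φ₁, h₁, h₁'⟩ := NumberField.exists_ringHom_two hm' hirr hroot hgen hβ hAS ha15 hb
    obtain ⟨φ₂, h₂, h₂'⟩ := NumberField.exists_ringHom_two hm' hirr hroot hgen hβ hAS ha15
      (b := b + 1) (by linear_combination hb + b * h2)
    exact ⟨φ₁, φ₂, h₁, h₂, by rw [h₁', h₂']; simp⟩

theorem theorem2 (m : ℤ) (hm : Squarefree m) (hm1 : m ≠ 1) (hm2 : m ≠ -1)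
    (K : Type*) [Field K] [NumberField K] (α : K)
    (hroot : Polynomial.aeval α (Polynomial.X ^ 60 - Polynomial.C m : Polynomial ℤ) = 0)
    (hgen : IntermediateField.adjoin ℚ {α} = ⊤)
    (h : m ≡ 1 [ZMOD 4] ∨
      (m ≡ 1 [ZMOD 9] ∨ m ≡ -1 [ZMOD 9]) ∨
      (m ≡ 1 [ZMOD 25] ∨ m ≡ -1 [ZMOD 25])) :
    ¬ IsMonogenicField K := by
  have hirr := Int.irreducible_X_pow_sub_C_of_squarefree hm hm1 hm2 (n := 60) (by norm_num)
  obtain ⟨α, rfl⟩ : ∃ a : 𝓞 K, (a : K) = α :=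
    ⟨⟨α, _, monic_X_pow_sub_C m (by norm_num), hroot⟩, rfl⟩
  have hroot' : α ^ 60 = m := by
    apply RingOfIntegers.ext
    simpa [sub_eq_zero] using hroot
  rcases h with h | (h | h) | (h | h)
  · exact not_isMonogenicField_of_modEq_four h hirr hroot' hgen
  · exact not_isMonogenicField_of_modEq_nine (Or.inl rfl) h hirr hroot' hgen
  · exact not_isMonogenicField_of_modEq_nine (Or.inr rfl) h hirr hroot' hgen
  · exact not_isMonogenicField_of_modEq_twentyFive (Or.inl rfl) h hirr hroot' hgen
  · exact not_isMonogenicField_of_modEq_twentyFive (Or.inr rfl) h hirr hroot' hgen
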